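/- Let $R>0$ and let $|\cdot|$ be the Euclidean norm on $\mathbb R^2$; write $B(x,\rho)=\{y\in\mathbb R^2:|y-x|<\rho\}$ and $S^1=\{v\in\mathbb R^2:|v|=1\}$. Let $A\subset\mathbb R^2$ be an $R$-body, that is, a nonempty closed set such that every point $y\in\mathbb R^2\setminus A$ lies in some open ball of radius $R$ that is disjoint from $A$. For $a\in\partial A$ let $$\mathcal N_R(A,a)=\{v\in S^1:\ A\cap B(a+Rv,R)=\emptyset\}.$$ A set $\mathcal K\subset S^1$ is called spherically convex if $\mathcal K=\mathrm{co}(K)\cap S^1$, where $K=\{\lambda v: v\in\mathcal K,\ \lambda\ge 0\}$ and $\mathrm{co}$ denotes the convex hull. If $\mathcal N_R(A,a)$ is spherically convex for every $a\in\partial A$, then $\mathrm{reach}(A)\ge R$. Here $\mathrm{reach}(A)=\inf_{a\in A}\mathrm{reach}(A,a)\in[0,\infty]$, where $\mathrm{reach}(A,a)$ is the supremum of all $\rho>0$ such that every $x\in B(a,\rho)$ has a unique nearest point in $A$ (and $\mathrm{reach}(A,a)=0$ if there is no such $\rho$). -/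

import Mathlib

open scoped ENNReal

namespace RBodies

/-- A body: a nonempty closed subset of Euclidean space. -/
def IsBody {d : ℕ} (A : Set (EuclideanSpace ℝ (Fin d))) : Prop :=
  A.Nonempty ∧ IsClosed A

/-- An `R`-body: a body each of whose exterior points lies in an open ball of radius `R`
contained in the complement. -/
def IsRBody {d : ℕ} (R : ℝ) (A : Set (EuclideanSpace ℝ (Fin d))) : Prop :=
  IsBody A ∧ ∀ y ∈ Aᶜ, ∃ c, y ∈ Metric.ball c R ∧ Metric.ball c R ⊆ Aᶜ

/-- `𝒩_R(A, a)`: the unit vectors `v` such that the open ball of radius `R` centred at `a + R v`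
does not meet `A`. -/
def supportingVectors {d : ℕ} (R : ℝ) (A : Set (EuclideanSpace ℝ (Fin d)))
    (a : EuclideanSpace ℝ (Fin d)) : Set (EuclideanSpace ℝ (Fin d)) :=
  {v | v ∈ Metric.sphere 0 1 ∧ A ⊆ (Metric.ball (a + R • v) R)ᶜ}

/-- The cone `{t v : v ∈ K, t ≥ 0}` related to a subset `K` of the unit sphere. -/
def relatedCone {d : ℕ} (K : Set (EuclideanSpace ℝ (Fin d))) :
    Set (EuclideanSpace ℝ (Fin d)) :=
  {x | ∃ v ∈ K, ∃ t : ℝ, 0 ≤ t ∧ x = t • v}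

/-- The spherical convex hull of a subset `K` of the unit sphere. -/
def sphericalHull {d : ℕ} (K : Set (EuclideanSpace ℝ (Fin d))) :
    Set (EuclideanSpace ℝ (Fin d)) :=
  convexHull ℝ (relatedCone K) ∩ Metric.sphere 0 1

/-- A subset of the unit sphere is spherically convex if it is its own spherical convex hull. -/
def IsSphericallyConvex {d : ℕ} (K : Set (EuclideanSpace ℝ (Fin d))) : Prop :=
  sphericalHull K = K

/-- `Unp(A)`: the points having a unique nearest point in `A`. -/
def unp {d : ℕ} (A : Set (EuclideanSpace ℝ (Fin d))) : Set (EuclideanSpace ℝ (Fin d)) :=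
  {x | ∃! b, b ∈ A ∧ dist b x = Metric.infDist x A}

/-- `reach(A, a)`, the supremum of the `ρ > 0` with `B(a, ρ) ⊆ Unp(A)`, in `[0, ∞]`
(it is `0` if there is no such `ρ`). -/
noncomputable def reachAt {d : ℕ} (A : Set (EuclideanSpace ℝ (Fin d)))
    (a : EuclideanSpace ℝ (Fin d)) : ℝ≥0∞ :=
  sSup {s | ∃ ρ : ℝ, 0 < ρ ∧ Metric.ball a ρ ⊆ unp A ∧ s = ENNReal.ofReal ρ}

/-- `reach(A)`, the infimum of `reach(A, a)` over `a ∈ A`. -/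
noncomputable def reach {d : ℕ} (A : Set (EuclideanSpace ℝ (Fin d))) : ℝ≥0∞ :=
  ⨅ a ∈ A, reachAt A a

end RBodies

open Filter Topology
open scoped Pointwise

namespace RBodies

local notation "𝔼" => EuclideanSpace ℝ (Fin 2)

/-! Let `x` be at distance `0 < r < R` from `A`, with nearest point `b` and unit direction `u` from
`b` to `x`. If `u` is a supporting vector at `b`, the disc `B(b + R u, R)` misses `A` and contains
the whole circle of radius `r` about `x` except `b`, so `b` is the only nearest point.

If `u` is not supporting, the cone over the supporting vectors, closed and convex, is separated from
`u`: some `w` has `⟪w, u⟫ > 0` and `⟪w, v⟫ ≤ 0` for all supporting `v`.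
`exists_supportingVector_inner_pos` excludes this. The points `b + τ w`, `τ → 0`, lie in the
touching disc, hence in `R`-discs missing `A`, which subconverge to a supporting disc with direction
`v ⊥ w`. Their directions `ν` from `b` satisfy `⟪w, ν⟫ > 0`, so they are not supporting and `B(b + R
ν, R)` contains a point of `A`. By `no_blocking_sequence` these blocking points would tend to `b`
tangentially to `w`, thus entering the touching disc. -/

/-! ### Limits of blocking points, in coordinates. -/

/-- The planar limiting argument in coordinates: `(s, k)` are unit vectors converging to `(0, 1)`
from the side `s > 0`, and `(x, y)` are points of the discs of radius `R` centred at `R (s, k)`. -/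
theorem no_blocking_sequence {R r u₁ u₂ X Y : ℝ} (hR : 0 < R) (hr : 0 < r) (hu : 0 < u₁)
    {x y s k t D : ℕ → ℝ} (hx : Tendsto x atTop (𝓝 X)) (hy : Tendsto y atTop (𝓝 Y))
    (hs : Tendsto s atTop (𝓝 0)) (hk : Tendsto k atTop (𝓝 1)) (ht : Tendsto t atTop (𝓝 0))
    (hD : Tendsto D atTop (𝓝 R)) (hs0 : ∀ n, 0 < s n) (hsk : ∀ n, s n ^ 2 + k n ^ 2 = 1)
    (hDR : ∀ n, R ≤ D n)
    (hin : ∀ n, x n ^ 2 + y n ^ 2 < 2 * R * (x n * s n + y n * k n))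
    (hout : ∀ n, 2 * R * y n ≤ x n ^ 2 + y n ^ 2)
    (hcov : ∀ n, R ^ 2 ≤ x n ^ 2 + y n ^ 2 - 2 * D n * (x n * s n + y n * k n) + D n ^ 2)
    (hcov' : ∀ n, R ^ 2 ≤ X ^ 2 + Y ^ 2 - 2 * D n * (X * s n + Y * k n) + D n ^ 2)
    (hball : ∀ n, D n ^ 2 - 2 * t n * D n * s n + t n ^ 2 < R ^ 2)
    (hprox : ∀ n, 2 * r * (x n * u₁ + y n * u₂) ≤ x n ^ 2 + y n ^ 2) : False := by
  have hq : Tendsto (fun n => x n * s n + y n * k n) atTop (𝓝 Y) := by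
    simpa using (hx.mul hs).add (hy.mul hk)
  have hsq : Tendsto (fun n => x n ^ 2 + y n ^ 2) atTop (𝓝 (X ^ 2 + Y ^ 2)) :=
    (hx.pow 2).add (hy.pow 2)
  have hcirc : X ^ 2 + Y ^ 2 = 2 * R * Y :=
    le_antisymm (le_of_tendsto_of_tendsto' hsq (hq.const_mul (2 * R)) fun n => (hin n).le)
      (le_of_tendsto_of_tendsto' (hy.const_mul (2 * R)) hsq hout)
  have hkpos : ∀ᶠ n in atTop, 0 < k n := hk.eventually_const_lt one_pos
  have hquot : Tendsto (fun n => s n / (1 + k n)) atTop (𝓝 0) := by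
    have h := hs.div (hk.const_add 1) (by norm_num)
    rwa [zero_div] at h
  have hk1 : ∀ n, 0 < k n → 1 - k n = s n * (s n / (1 + k n)) := fun n hn => by
    have := hsk n
    field_simp
    linarith
  -- Inside the tilted disc and outside the upright one: `(x, y)` lies beyond their common chord.
  have hxlow : ∀ᶠ n in atTop, y n * (s n / (1 + k n)) < x n := by
    filter_upwards [hkpos] with n hn
    have h1 : 2 * R * (y n * (1 - k n)) < 2 * R * (x n * s n) := by
      linarith [hin n, hout n]
    have h2 := lt_of_mul_lt_mul_left h1 (by positivity)
    rw [hk1 n hn] at h2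
    exact lt_of_mul_lt_mul_left (by linarith) (hs0 n).le
  have hX0 : 0 ≤ X :=
    le_of_tendsto_of_tendsto (by simpa using hy.mul hquot) hx (hxlow.mono fun _ h => h.le)
  -- Lying in the disc centred at distance `R` but not in the one at distance `D` in the same
  -- direction puts the point below the bisector, at height `(D + R) / 2`. This later rules out the
  -- antipode `Y = 2 * R`.
  have hYR : Y ≤ R := by
    have h1 : ∀ n, 2 * (x n * s n + y n * k n) ≤ D n + R := fun n => by
      have h : 0 < (D n - R) * (D n + R - 2 * (x n * s n + y n * k n)) := by
        linarith [hin n, hcov n]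
      by_contra hc
      nlinarith [hDR n]
    have := le_of_tendsto_of_tendsto' (hq.const_mul 2) (hD.add_const R) h1
    linarith
  have hY0 : 0 ≤ Y := by
    have : 0 ≤ 2 * R * Y := hcirc ▸ by positivity
    exact nonneg_of_mul_nonneg_right this (by positivity)
  -- The limit point also avoids every covering disc, and these contain `(t, 0)`; this bounds `X`
  -- from above by a null sequence.
  have hX1 : X ≤ 0 := by
    have h1 : ∀ᶠ n in atTop, X ≤ Y * (s n / (1 + k n)) + t n := by
      filter_upwards [hkpos] with n hn
      have hDn : 0 < D n := hR.trans_le (hDR n)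
      have h2 : 2 * D n * s n * X ≤ 2 * D n * s n * (Y * (s n / (1 + k n)) + t n) := by
        have e : 2 * D n * s n * (Y * (s n / (1 + k n)) + t n)
            = 2 * D n * Y * (1 - k n) + 2 * t n * D n * s n := by rw [hk1 n hn]; ring
        rw [e]
        nlinarith [hcov' n, hball n, mul_nonneg (sub_nonneg.2 (hDR n)) hY0, sq_nonneg (t n)]
      exact le_of_mul_le_mul_left h2 (by have := hs0 n; positivity)
    exact le_of_tendsto_of_tendsto tendsto_const_nhds
      (by simpa using (hquot.const_mul Y).add ht) h1
  obtain rfl : X = 0 := le_antisymm hX1 hX0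
  obtain rfl : Y = 0 := by
    by_contra hne
    have : 0 < Y := lt_of_le_of_ne hY0 (Ne.symm hne)
    nlinarith
  have hyR : ∀ᶠ n in atTop, y n < R := hy.eventually_lt_const hR
  -- The slope is bounded by the upright circle when `y ≥ 0`, and by the tangent line of the tilted
  -- circle when `y < 0`.
  have hxz : ∀ᶠ n in atTop, 0 < x n ∧ |y n / x n| ≤ x n / R + s n / k n := by
    filter_upwards [hkpos, hyR, hxlow] with n hn hyn hxn
    have hsn := hs0 n
    rcases le_or_gt 0 (y n) with h0 | h0
    · have hxp : 0 < x n := lt_of_le_of_lt (by positivity) hxn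
      refine ⟨hxp, ?_⟩
      rw [abs_of_nonneg (by positivity)]
      have : y n / x n ≤ x n / R := by
        rw [div_le_div_iff₀ hxp hR]
        nlinarith [hout n]
      have : 0 < s n / k n := by positivity
      linarith
    · have hpos : 0 < x n * s n + y n * k n := by
        have : 0 < 2 * R * (x n * s n + y n * k n) :=
          lt_of_le_of_lt (by positivity) (hin n)
        exact (mul_pos_iff_of_pos_left (by positivity)).1 this
      have hxp : 0 < x n := by
        have : 0 < x n * s n := by nlinarith
        exact (mul_pos_iff_of_pos_right hsn).1 this
      refine ⟨hxp, ?_⟩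
      rw [abs_of_neg (div_neg_of_neg_of_pos h0 hxp), ← neg_div]
      have : -y n / x n ≤ s n / k n := by
        rw [div_le_div_iff₀ hxp hn]
        linarith
      have : 0 < x n / R := by positivity
      linarith
  have hz : Tendsto (fun n => y n / x n) atTop (𝓝 0) := by
    refine squeeze_zero_norm' (a := fun n => x n / R + s n / k n) (hxz.mono fun n h => h.2) ?_
    simpa using (hx.div_const R).add (hs.div hk one_ne_zero)
  -- Dividing `hprox` by `x > 0` gives `2 * r * u₁ ≤ 0` in the limit.
  have hfin : ∀ᶠ n in atTop,
      2 * r * (u₁ + y n / x n * u₂) ≤ x n * (1 + (y n / x n) ^ 2) := by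
    filter_upwards [hxz] with n hn
    have hxp := hn.1
    refine le_of_mul_le_mul_left ?_ hxp
    have e1 : x n * (2 * r * (u₁ + y n / x n * u₂)) = 2 * r * (x n * u₁ + y n * u₂) := by
      field_simp
    have e2 : x n * (x n * (1 + (y n / x n) ^ 2)) = x n ^ 2 + y n ^ 2 := by
      field_simp
    rw [e1, e2]
    exact hprox n
  have hlim := le_of_tendsto_of_tendsto (((hz.mul_const u₂).const_add u₁).const_mul (2 * r))
    (hx.mul ((hz.pow 2).const_add 1)) hfin
  have : 0 < 2 * r * u₁ := by positivity
  norm_num at hlim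
  nlinarith

/-! ### Supporting vectors and covering discs in the plane. -/

/-- Parseval's identity for two orthonormal vectors of the plane. -/
theorem inner_eq_of_orthonormal {w v : 𝔼} (hw : ‖w‖ = 1) (hv : ‖v‖ = 1) (hwv : inner ℝ w v = 0)
    (p q : 𝔼) : inner ℝ p q = inner ℝ w p * inner ℝ w q + inner ℝ v p * inner ℝ v q := by
  have ho : Orthonormal ℝ ![w, v] := by
    rw [orthonormal_iff_ite]
    intro i j
    fin_cases i <;> fin_cases j <;>
      simp [hw, hv, hwv, real_inner_comm w v]
  let b := basisOfOrthonormalOfCardEqFinrank ho (by simp)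
  have hb : ⇑b = ![w, v] := coe_basisOfOrthonormalOfCardEqFinrank ho (by simp)
  let o := b.toOrthonormalBasis (by rw [hb]; exact ho)
  have ho' : ⇑o = ![w, v] := by simp [o, hb]
  have := o.sum_inner_mul_inner p q
  rw [ho'] at this
  simp only [Fin.sum_univ_two, Matrix.cons_val_zero, Matrix.cons_val_one] at this
  rw [← this, real_inner_comm p w, real_inner_comm p v]

theorem le_norm_sub_of_mem {d : ℕ} {A : Set (EuclideanSpace ℝ (Fin d))}
    {b c : EuclideanSpace ℝ (Fin d)} {ρ : ℝ} (h : Metric.ball c ρ ⊆ Aᶜ) (hb : b ∈ A) :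
    ρ ≤ ‖b - c‖ := by
  by_contra hlt
  exact h (by rw [Metric.mem_ball, dist_eq_norm]; exact not_le.1 hlt) hb

theorem mem_supportingVectors_iff {d : ℕ} {R : ℝ} {A : Set (EuclideanSpace ℝ (Fin d))}
    {a v : EuclideanSpace ℝ (Fin d)} :
    v ∈ supportingVectors R A a ↔ ‖v‖ = 1 ∧ ∀ b ∈ A, R ≤ ‖b - (a + R • v)‖ := by
  simp [supportingVectors, Set.subset_def, dist_eq_norm]

theorem isCompact_supportingVectors {d : ℕ} (R : ℝ) (A : Set (EuclideanSpace ℝ (Fin d)))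
    (a : EuclideanSpace ℝ (Fin d)) : IsCompact (supportingVectors R A a) := by
  have h : supportingVectors R A a =
      Metric.sphere 0 1 ∩ ⋂ b ∈ A, {v | R ≤ ‖b - (a + R • v)‖} := by
    ext v
    simp [mem_supportingVectors_iff]
  rw [h]
  refine (isCompact_sphere 0 1).inter_right (isClosed_biInter fun b _ => ?_)
  exact isClosed_le continuous_const (by fun_prop)

/-- If a disc touches a planar `R`-body at `a` from the direction `u`, then on every open side
containing `u` there is a supporting vector at `a`. -/
theorem exists_supportingVector_inner_pos {R : ℝ} (hR : 0 < R) {A : Set 𝔼} (hA : IsRBody R A)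
    {a : 𝔼} (ha : a ∈ A) {r : ℝ} (hr : 0 < r) {u : 𝔼} (hu : ‖u‖ = 1)
    (hball : Metric.ball (a + r • u) r ⊆ Aᶜ) {w : 𝔼} (hw : ‖w‖ = 1) (hwu : 0 < inner ℝ w u) :
    ∃ v ∈ supportingVectors R A a, 0 < inner ℝ w v := by
  by_contra! hN
  -- The ray from `a` along `w` stays in the touching disc for `0 < τ < 2 * r * ⟪w, u⟫`.
  set τ : ℕ → ℝ := fun n => 1 / ((n : ℝ) + 1) * (r * inner ℝ w u) with hτ
  have hτ0 : ∀ n, 0 < τ n := fun n => by positivity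
  have hτle : ∀ n, τ n ≤ r * inner ℝ w u := fun n =>
    mul_le_of_le_one_left (by positivity) (by
      rw [div_le_one (by positivity)]; linarith [n.cast_nonneg (α := ℝ)])
  have hτlim : Tendsto τ atTop (𝓝 0) := by
    have h := (tendsto_one_div_add_atTop_nhds_zero_nat (𝕜 := ℝ)).mul_const (r * inner ℝ w u)
    rwa [zero_mul] at h
  have hout : ∀ n, a + τ n • w ∈ Aᶜ := fun n => hball (by
    rw [Metric.mem_ball, dist_eq_norm, add_sub_add_left_eq_sub]
    refine lt_of_pow_lt_pow_left₀ 2 hr.le ?_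
    rw [norm_sub_sq_real, norm_smul, norm_smul, inner_smul_left, inner_smul_right, hw, hu,
      mul_one, mul_one, Real.norm_eq_abs, Real.norm_eq_abs, sq_abs, sq_abs]
    simp only [conj_trivial]
    nlinarith [mul_pos (hτ0 n) (mul_pos hr hwu), mul_le_mul_of_nonneg_left (hτle n) (hτ0 n).le])
  choose c hc hcA using fun n => hA.2 _ (hout n)
  have hge : ∀ n, ∀ b ∈ A, R ≤ ‖b - c n‖ := fun n b hb => le_norm_sub_of_mem (hcA n) hb
  set e : ℕ → 𝔼 := fun n => c n - a with he
  have heR : ∀ n, R ≤ ‖e n‖ := fun n => by rw [he, norm_sub_rev]; exact hge n a ha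
  have hlt : ∀ n, ‖e n - τ n • w‖ < R := fun n => by
    have := hc n
    rw [Metric.mem_ball, dist_eq_norm, norm_sub_rev] at this
    rwa [show c n - (a + τ n • w) = e n - τ n • w by rw [← sub_sub]] at this
  have hbdd : ∀ n, e n ∈ Metric.closedBall (0 : 𝔼) (R + r * inner ℝ w u) := fun n => by
    rw [mem_closedBall_zero_iff]
    calc ‖e n‖ = ‖(e n - τ n • w) + τ n • w‖ := by rw [sub_add_cancel]
      _ ≤ ‖e n - τ n • w‖ + ‖τ n • w‖ := norm_add_le _ _
      _ ≤ R + r * inner ℝ w u := by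
        rw [norm_smul, hw, mul_one, Real.norm_of_nonneg (hτ0 n).le]
        exact add_le_add (hlt n).le (hτle n)
  obtain ⟨e₀, -, φ, hφ, heφ⟩ := (isCompact_closedBall (0 : 𝔼) _).tendsto_subseq hbdd
  have hτφ := hτlim.comp hφ.tendsto_atTop
  have hnorm : Tendsto (fun n => ‖e (φ n)‖) atTop (𝓝 ‖e₀‖) := heφ.norm
  have he₀ : ‖e₀‖ = R := by
    refine le_antisymm ?_ (ge_of_tendsto' hnorm fun n => heR _)
    have : Tendsto (fun n => ‖e (φ n) - τ (φ n) • w‖) atTop (𝓝 ‖e₀ - (0 : ℝ) • w‖) :=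
      (heφ.sub (hτφ.smul_const w)).norm
    rw [zero_smul, sub_zero] at this
    exact le_of_tendsto' this fun n => (hlt _).le
  rw [he₀] at hnorm
  set v : 𝔼 := R⁻¹ • e₀ with hvdef
  have hRv : R • v = e₀ := by rw [hvdef, smul_inv_smul₀ hR.ne']
  have hv1 : ‖v‖ = 1 := by
    rw [hvdef, norm_smul, he₀, norm_inv, Real.norm_of_nonneg hR.le, inv_mul_cancel₀ hR.ne']
  have hvN : v ∈ supportingVectors R A a := by
    refine mem_supportingVectors_iff.2 ⟨hv1, fun b hb => ?_⟩
    rw [hRv]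
    have : Tendsto (fun n => ‖b - (a + e (φ n))‖) atTop (𝓝 ‖b - (a + e₀)‖) :=
      ((heφ.const_add a).const_sub b).norm
    refine ge_of_tendsto' this fun n => ?_
    have := hge (φ n) b hb
    simpa [he] using this
  have hball2 : ∀ n, ‖e n‖ ^ 2 - 2 * τ n * inner ℝ w (e n) + τ n ^ 2 < R ^ 2 := fun n => by
    have h := pow_lt_pow_left₀ (hlt n) (norm_nonneg _) two_ne_zero
    rw [norm_sub_sq_real, norm_smul, inner_smul_right, hw, mul_one, Real.norm_eq_abs, sq_abs,
      real_inner_comm] at h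
    linarith
  have hwe : ∀ n, 0 < inner ℝ w (e n) := fun n => by
    have h1 := hball2 n
    have h2 : R ^ 2 ≤ ‖e n‖ ^ 2 := pow_le_pow_left₀ hR.le (heR n) 2
    have h3 : 0 < τ n * inner ℝ w (e n) := by nlinarith [sq_nonneg (τ n)]
    exact (mul_pos_iff_of_pos_left (hτ0 n)).1 h3
  set ν : ℕ → 𝔼 := fun n => ‖e n‖⁻¹ • e n with hνdef
  have hepos : ∀ n, 0 < ‖e n‖ := fun n => hR.trans_le (heR n)
  have hν1 : ∀ n, ‖ν n‖ = 1 := fun n => by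
    simp only [hνdef, norm_smul, norm_inv, norm_norm, inv_mul_cancel₀ (hepos n).ne']
  have heν : ∀ n, ‖e n‖ • ν n = e n := fun n => smul_inv_smul₀ (hepos n).ne' _
  have hνlim : Tendsto (fun n => ν (φ n)) atTop (𝓝 v) := (hnorm.inv₀ hR.ne').smul heφ
  have hwν : ∀ n, 0 < inner ℝ w (ν n) := fun n => by
    simp only [hνdef, inner_smul_right]
    exact mul_pos (inv_pos.2 (hepos n)) (hwe n)
  have hwνlim : Tendsto (fun n => inner ℝ w (ν (φ n))) atTop (𝓝 (inner ℝ w v)) :=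
    tendsto_const_nhds.inner hνlim
  have hwv : inner ℝ w v = 0 :=
    le_antisymm (hN v hvN) (ge_of_tendsto' hwνlim fun n => (hwν _).le)
  -- Since `⟪w, ν n⟫ > 0`, the assumption `hN` prevents `ν n` from being supporting.
  have hblock : ∀ n, ∃ p : 𝔼, a + p ∈ A ∧ ‖p - R • ν n‖ < R := fun n => by
    by_contra! hcon
    refine (hN (ν n) (mem_supportingVectors_iff.2 ⟨hν1 n, fun b hb => ?_⟩)).not_gt (hwν n)
    have := hcon (b - a) (by simpa using hb)
    rwa [sub_sub] at this
  choose p hpA hpR using hblock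
  have hpb : ∀ n, p (φ n) ∈ Metric.closedBall (0 : 𝔼) (R + R) := fun n => by
    rw [mem_closedBall_zero_iff]
    calc ‖p (φ n)‖ = ‖(p (φ n) - R • ν (φ n)) + R • ν (φ n)‖ := by rw [sub_add_cancel]
      _ ≤ _ := norm_add_le _ _
      _ ≤ R + R := by
        rw [norm_smul, hν1, mul_one, Real.norm_of_nonneg hR.le]
        exact add_le_add (hpR _).le le_rfl
  obtain ⟨p₀, -, ψ, hψ, hpψ⟩ := (isCompact_closedBall (0 : 𝔼) _).tendsto_subseq hpb
  have hp₀ : a + p₀ ∈ A :=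
    hA.1.2.mem_of_tendsto (hpψ.const_add a) (Eventually.of_forall fun n => hpA _)
  have hψt := hψ.tendsto_atTop
  have hpars := inner_eq_of_orthonormal hw hv1 hwv
  have hsq : ∀ q : 𝔼, ‖q‖ ^ 2 = inner ℝ w q ^ 2 + inner ℝ v q ^ 2 := fun q => by
    rw [← real_inner_self_eq_norm_sq, hpars]; ring
  have hexp : ∀ (q z : 𝔼) (ρ : ℝ), ‖z‖ = 1 → ‖q - ρ • z‖ ^ 2 = inner ℝ w q ^ 2 + inner ℝ v q ^ 2
      - 2 * ρ * (inner ℝ w q * inner ℝ w z + inner ℝ v q * inner ℝ v z) + ρ ^ 2 := by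
    intro q z ρ hz
    rw [norm_sub_sq_real, norm_smul, inner_smul_right, hsq q, hz, hpars q z, mul_one,
      Real.norm_eq_abs, sq_abs]
    ring
  have hcover : ∀ (q : 𝔼) (n : ℕ), a + q ∈ A → R ^ 2 ≤ inner ℝ w q ^ 2 + inner ℝ v q ^ 2
      - 2 * ‖e n‖ * (inner ℝ w q * inner ℝ w (ν n) + inner ℝ v q * inner ℝ v (ν n))
      + ‖e n‖ ^ 2 := fun q n hq => by
    rw [← hexp q (ν n) _ (hν1 n), heν]
    refine pow_le_pow_left₀ hR.le ?_ 2
    have := hge n _ hq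
    rwa [show a + q - c n = q - e n by rw [show e n = c n - a from rfl]; abel] at this
  refine no_blocking_sequence (r := r) (u₁ := inner ℝ w u) (u₂ := inner ℝ v u)
    (X := inner ℝ w p₀) (Y := inner ℝ v p₀)
    (x := fun n => inner ℝ w (p (φ (ψ n)))) (y := fun n => inner ℝ v (p (φ (ψ n))))
    (s := fun n => inner ℝ w (ν (φ (ψ n)))) (k := fun n => inner ℝ v (ν (φ (ψ n))))
    (t := fun n => τ (φ (ψ n))) (D := fun n => ‖e (φ (ψ n))‖) hR hr hwu
    (tendsto_const_nhds.inner hpψ) (tendsto_const_nhds.inner hpψ)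
    (hwv ▸ hwνlim.comp hψt) ?_ (hτφ.comp hψt) (hnorm.comp hψt) (fun n => hwν _) ?_
    (fun n => heR _) ?_ ?_ (fun n => hcover _ _ (hpA _)) (fun n => hcover _ _ hp₀) ?_ ?_
  · have h : Tendsto (fun n => inner ℝ v (ν (φ n))) atTop (𝓝 (inner ℝ v v)) :=
      tendsto_const_nhds.inner hνlim
    rw [real_inner_self_eq_norm_sq, hv1, one_pow] at h
    exact h.comp hψt
  · intro n
    rw [← hsq, hν1, one_pow]
  · intro n
    have h := pow_lt_pow_left₀ (hpR (φ (ψ n))) (norm_nonneg _) two_ne_zero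
    rw [hexp _ _ _ (hν1 _)] at h
    linarith
  · intro n
    have h := pow_le_pow_left₀ hR.le ((mem_supportingVectors_iff.1 hvN).2 _ (hpA (φ (ψ n)))) 2
    rw [add_sub_add_left_eq_sub, hexp _ _ _ hv1, hwv, real_inner_self_eq_norm_sq, hv1] at h
    linarith
  · intro n
    have h := hball2 (φ (ψ n))
    have h2 : inner ℝ w (e (φ (ψ n))) = ‖e (φ (ψ n))‖ * inner ℝ w (ν (φ (ψ n))) := by
      rw [← inner_smul_right, heν]
    rw [h2] at h
    linarith
  · intro n
    have h := pow_le_pow_left₀ hr.le (le_norm_sub_of_mem hball (hpA (φ (ψ n)))) 2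
    rw [add_sub_add_left_eq_sub, hexp _ _ _ hu] at h
    linarith

/-! ### Cones over spherically convex sets and separation. -/

/-- For a spherically convex set `K`, the cone over `K` is convex. -/
theorem convexHull_relatedCone_eq {d : ℕ} {K : Set (EuclideanSpace ℝ (Fin d))}
    (hK : IsSphericallyConvex K) (hne : K.Nonempty) :
    convexHull ℝ (relatedCone K) = relatedCone K := by
  refine Set.Subset.antisymm (fun x hx => ?_) (subset_convexHull ℝ _)
  rcases eq_or_ne x 0 with rfl | hx0
  · obtain ⟨v, hv⟩ := hne
    exact ⟨v, hv, 0, le_rfl, by simp⟩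
  · have hn : 0 < ‖x‖ := norm_pos_iff.2 hx0
    refine ⟨‖x‖⁻¹ • x, ?_, ‖x‖, hn.le, (smul_inv_smul₀ hn.ne' x).symm⟩
    rw [← hK]
    refine ⟨?_, by simp [norm_smul, hn.ne']⟩
    have hmem : ‖x‖⁻¹ • x ∈ ‖x‖⁻¹ • convexHull ℝ (relatedCone K) := Set.smul_mem_smul_set hx
    rw [← convexHull_smul] at hmem
    refine convexHull_mono ?_ hmem
    rintro _ ⟨_, ⟨v, hv, t, ht, rfl⟩, rfl⟩
    exact ⟨v, hv, ‖x‖⁻¹ * t, by positivity, by simp [smul_smul]⟩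

/-- On the unit sphere the scaling factor is the norm, so it converges along with the points;
compactness supplies a limit direction. -/
theorem isClosed_relatedCone {d : ℕ} {K : Set (EuclideanSpace ℝ (Fin d))} (hK : IsCompact K)
    (hsub : K ⊆ Metric.sphere 0 1) : IsClosed (relatedCone K) := by
  refine isClosed_of_closure_subset fun x hx => ?_
  obtain ⟨f, hf, hlim⟩ := mem_closure_iff_seq_limit.1 hx
  choose v hv t ht hft using hf
  obtain ⟨v₀, hv₀, φ, hφ, hvφ⟩ := hK.tendsto_subseq hv
  have hn : ∀ n, ‖f n‖ = t n := fun n => by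
    rw [hft, norm_smul, Real.norm_of_nonneg (ht n), mem_sphere_zero_iff_norm.1 (hsub (hv n)),
      mul_one]
  refine ⟨v₀, hv₀, ‖x‖, norm_nonneg x, ?_⟩
  have h1 : Tendsto (fun n => f (φ n)) atTop (𝓝 x) := hlim.comp hφ.tendsto_atTop
  have h2 : Tendsto (fun n => f (φ n)) atTop (𝓝 (‖x‖ • v₀)) := by
    refine (h1.norm.smul hvφ).congr fun n => ?_
    simp only [hn, Function.comp]
    exact (hft _).symm
  exact tendsto_nhds_unique h1 h2

/-- A unit vector lying outside a nonempty compact spherically convex set is strictly separated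
from it by a hyperplane through the origin. -/
theorem exists_separating_of_notMem {d : ℕ} {K : Set (EuclideanSpace ℝ (Fin d))}
    (hK : IsCompact K) (hsub : K ⊆ Metric.sphere 0 1) (hconv : IsSphericallyConvex K)
    (hne : K.Nonempty) {u : EuclideanSpace ℝ (Fin d)} (hu : ‖u‖ = 1) (huK : u ∉ K) :
    ∃ w : EuclideanSpace ℝ (Fin d), ‖w‖ = 1 ∧ 0 < inner ℝ w u ∧ ∀ v ∈ K, inner ℝ w v ≤ 0 := by
  have heq := convexHull_relatedCone_eq hconv hne
  have hcv : Convex ℝ (relatedCone K) := heq ▸ convex_convexHull ℝ _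
  have hu' : u ∉ relatedCone K := fun h => huK (by
    rw [← hconv]
    exact ⟨subset_convexHull ℝ _ h, by simpa using hu⟩)
  obtain ⟨f, α, hf, hfu⟩ := geometric_hahn_banach_closed_point hcv
    (isClosed_relatedCone hK hsub) hu'
  have hα : 0 < α := by
    obtain ⟨v, hv⟩ := hne
    simpa using hf 0 ⟨v, hv, 0, le_rfl, by simp⟩
  set w := (InnerProductSpace.toDual ℝ (EuclideanSpace ℝ (Fin d))).symm f with hw
  have hwf : ∀ x, inner ℝ w x = f x := fun x => InnerProductSpace.toDual_symm_apply
  have hwu : 0 < inner ℝ w u := by rw [hwf]; exact hα.trans hfu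
  have hw0 : 0 < ‖w‖ := norm_pos_iff.2 (by rintro h; simp [h] at hwu)
  refine ⟨‖w‖⁻¹ • w, by simp [norm_smul, hw0.ne'], ?_, fun v hv => ?_⟩
  · rw [real_inner_smul_left]; positivity
  · rw [real_inner_smul_left]
    refine mul_nonpos_of_nonneg_of_nonpos (by positivity) ?_
    by_contra! hpos
    -- On the cone `f < α`, yet this multiple of `v` would have `f` equal to `α`.
    have := hf ((α / inner ℝ w v) • v) ⟨v, hv, α / inner ℝ w v, by positivity, rfl⟩
    rw [map_smul, ← hwf, smul_eq_mul, div_mul_cancel₀ _ hpos.ne'] at this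
    exact lt_irrefl _ this

/-! ### From touching discs to unique nearest points. -/

/-- The direction of a disc touching the set at `a` is a supporting vector at `a`. -/
theorem mem_supportingVectors_of_ball_subset {R : ℝ} (hR : 0 < R) {A : Set 𝔼}
    (hA : IsRBody R A) {a : 𝔼} (ha : a ∈ A)
    (hconv : IsSphericallyConvex (supportingVectors R A a)) {r : ℝ} (hr : 0 < r) {u : 𝔼}
    (hu : ‖u‖ = 1) (hball : Metric.ball (a + r • u) r ⊆ Aᶜ) : u ∈ supportingVectors R A a := by
  by_contra hmem
  -- Taking `w = u` shows that supporting vectors exist, as the separation requires.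
  obtain ⟨v₀, hv₀, -⟩ := exists_supportingVector_inner_pos hR hA ha hr hu hball hu
    (by rw [real_inner_self_eq_norm_sq, hu]; norm_num)
  obtain ⟨w, hw, hwu, hwN⟩ := exists_separating_of_notMem (isCompact_supportingVectors R A a)
    (fun v hv => hv.1) hconv ⟨v₀, hv₀⟩ hu hmem
  obtain ⟨v, hv, hpos⟩ := exists_supportingVector_inner_pos hR hA ha hr hu hball hw hwu
  exact (hwN v hv).not_gt hpos

/-- The larger of two discs internally tangent at `a` contains every other point of the boundary
of the smaller one. -/
theorem norm_sub_lt_of_internally_tangent {d : ℕ} {a b u : EuclideanSpace ℝ (Fin d)} {r R : ℝ}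
    (hr : 0 < r) (hrR : r < R) (hu : ‖u‖ = 1) (hab : b ≠ a) (hb : ‖b - (a + r • u)‖ = r) :
    ‖b - (a + R • u)‖ < R := by
  have hR := hr.trans hrR
  have hq : 0 < ‖b - a‖ ^ 2 := pow_pos (norm_pos_iff.2 (sub_ne_zero.2 hab)) 2
  have hexp : ∀ ρ : ℝ, ‖b - (a + ρ • u)‖ ^ 2
      = ‖b - a‖ ^ 2 - 2 * ρ * inner ℝ (b - a) u + ρ ^ 2 := fun ρ => by
    rw [← sub_sub, norm_sub_sq_real, norm_smul, inner_smul_right, hu, mul_one, Real.norm_eq_abs,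
      sq_abs]
    ring
  have h1 := hexp r
  rw [hb] at h1
  refine lt_of_pow_lt_pow_left₀ 2 hR.le ?_
  rw [hexp R]
  have h2 : 0 < inner ℝ (b - a) u := by
    refine (mul_pos_iff_of_pos_left (a := 2 * r) (by positivity)).1 ?_
    linarith
  nlinarith [mul_pos (sub_pos.2 hrR) h2]

/-- Every point at distance less than `R` from the set has a unique nearest point. -/
theorem mem_unp_of_infDist_lt {R : ℝ} (hR : 0 < R) {A : Set 𝔼} (hA : IsRBody R A)
    (hconv : ∀ a ∈ frontier A, IsSphericallyConvex (supportingVectors R A a)) {x : 𝔼}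
    (hx : Metric.infDist x A < R) : x ∈ unp A := by
  obtain ⟨b, hb, hbx⟩ := hA.1.2.exists_infDist_eq_dist hA.1.1 x
  refine ⟨b, ⟨hb, by rw [hbx, dist_comm]⟩, fun b' ⟨hb', hbx'⟩ => ?_⟩
  by_contra hne
  set r := Metric.infDist x A with hrdef
  have hr : 0 < r := by
    refine lt_of_le_of_ne Metric.infDist_nonneg fun h0 => hne ?_
    rw [← h0] at hbx hbx'
    rw [dist_eq_zero.1 hbx', dist_eq_zero.1 hbx.symm]
  have hballx : Metric.ball x r ⊆ Aᶜ := fun y hy hyA => by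
    have := Metric.infDist_le_dist_of_mem (x := x) hyA
    rw [Metric.mem_ball, dist_comm] at hy
    exact (lt_of_lt_of_le hy this).false
  -- As `r > 0`, the closure of the open disc about `x` contains `b`.
  have hfr : b ∈ frontier A := by
    rw [frontier_eq_closure_inter_closure]
    refine ⟨subset_closure hb, closure_mono hballx ?_⟩
    rw [closure_ball x hr.ne', Metric.mem_closedBall, dist_comm, ← hbx]
  set u : 𝔼 := r⁻¹ • (x - b) with hudef
  have hru : b + r • u = x := by rw [hudef, smul_inv_smul₀ hr.ne']; abel
  have hu : ‖u‖ = 1 := by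
    rw [hudef, norm_smul, ← dist_eq_norm, ← hbx, norm_inv, Real.norm_of_nonneg hr.le,
      inv_mul_cancel₀ hr.ne']
  have hmem := mem_supportingVectors_of_ball_subset hR hA hb (hconv b hfr) hr hu
    (by rwa [hru])
  refine ((mem_supportingVectors_iff.1 hmem).2 b' hb').not_gt
    (norm_sub_lt_of_internally_tangent hr hx hu hne ?_)
  rw [hru, ← dist_eq_norm, hbx']

end RBodies

theorem mainTheorem2 (R : ℝ) (hR : 0 < R) (A : Set (EuclideanSpace ℝ (Fin 2)))
    (hA : RBodies.IsRBody R A)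
    (hconv : ∀ a ∈ frontier A, RBodies.IsSphericallyConvex (RBodies.supportingVectors R A a)) :
    ENNReal.ofReal R ≤ RBodies.reach A := by
  refine le_iInf₂ fun a ha => le_sSup ⟨R, hR, fun x hx => ?_, rfl⟩
  exact RBodies.mem_unp_of_infDist_lt hR hA hconv
    ((Metric.infDist_le_dist_of_mem ha).trans_lt hx)
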